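/- Let $\mathcal M=(\mathcal S,\mathcal A,\mathcal R,\mathcal P,\gamma)$ be a Markov decision process: $\mathcal S$ and $\mathcal A\neq\emptyset$ are measurable spaces with measurable singletons (e.g. countable discrete), $\mathcal R:\mathcal S\times\mathcal A\to(-\infty,0]$ is measurable, $\mathcal P$ is a Markov transition kernel from $\mathcal S\times\mathcal A$ to $\mathcal S$, and $\gamma\in(0,1)$. Let $\Pi$ be the set of all stationary policies, i.e. Markov kernels $\pi$ from $\mathcal S$ to $\mathcal A$, and let $\mathcal X=\mathcal S\sqcup(\mathcal S\times\mathcal A)$. For $\pi\in\Pi$ and $x\in\mathcal X$, the trajectory $\xi_\pi(x)=(s_1,a_1,r_1,s_2,a_2,r_2,\dots)$ has $s_1=s,\ a_1\sim\pi(s)$ if $x=s\in\mathcal S$, and $(s_1,a_1)=(s,a)$ if $x=(s,a)$; further $s_{i+1}\sim\mathcal P(s_i,a_i)$ and $a_{i+1}\sim\pi(s_{i+1})$ for $i\ge1$, and $r_i=\mathcal R(s_i,a_i)$. The total cost from $x$ to $y$ is the random variable $C(x,y)=\sum_{t\ge1}(-r_t)\,\mathbf 1[y\text{ not reached before step }t]\in[0,\infty]$,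 where "$y$ has been reached before step $t$" means: - if $y=s'\in\mathcal S$ and $x\in\mathcal S$: $s'\in\{s_1,\dots,s_t\}$; - if $y=s'\in\mathcal S$ and $x\in\mathcal S\times\mathcal A$: $s'\in\{s_2,\dots,s_t\}$ (the trajectory begins by performing the given action, and only the states visited afterwards count); - if $y=(s',a')$ and $x\ne y$: $(s',a')\in\{(s_1,a_1),\dots,(s_{t-1},a_{t-1})\}$; - if $y=x\in\mathcal S\times\mathcal A$: always, so that $C(x,x)=0$. Define $$d_{\mathsf{sum}}(x,y)=\inf_{\pi\in\Pi}\mathbb E_{\xi_\pi(x)}[C(x,y)],\qquad d_\gamma(x,y)=\log_\gamma\ \sup_{\pi\in\Pi}\mathbb E_{\xi_\pi(x)}\big[\gamma^{C(x,y)}\big],$$ with $\gamma^\infty=0$ and $\log_\gamma 0=\infty$. A function $d:\mathcal X\times\mathcal X\to[0,\infty]$ is a quasipseudometric if $d(x,x)=0$ for all $x$ and $d(x,z)\le d(x,y)+d(y,z)$ for all $x,y,z$; it is a quasimetric if moreover $d(x,y)=0$ only for $x=y$. 1. $d_{\mathsf{sum}}$ and $d_\gamma$ are quasipseudometrics on $\mathcal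 X$. 2. If $\mathcal A$ is finite, then for all $x,y\in\mathcal X$ the infimum defining $d_{\mathsf{sum}}(x,y)$ and the supremum defining $d_\gamma(x,y)$ are attained, i.e. they are a minimum and a maximum. 3. Suppose $\mathcal R(s,a)<0$ for all $(s,a)$. If the infima defining $d_{\mathsf{sum}}$ are minima for all $x,y$ (in particular if $\mathcal A$ is finite), then $d_{\mathsf{sum}}$ is a quasimetric. If the suprema defining $d_\gamma$ are maxima for all $x,y$ (in particular if $\mathcal A$ is finite), then $d_\gamma$ is a quasimetric. -/

import Mathlib

open MeasureTheory ProbabilityTheory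
open scoped ENNReal

/-- A quasipseudometric `d : X × X → [0, ∞]`. -/
structure IsQuasipseudometric {X : Type*} (d : X → X → ℝ≥0∞) : Prop where
  eq_zero_of_eq : ∀ x y, x = y → d x y = 0
  triangle : ∀ x y z, d x z ≤ d x y + d y z

/-- A quasimetric `d : X × X → [0, ∞]`. -/
structure IsQuasimetric {X : Type*} (d : X → X → ℝ≥0∞) : Prop where
  eq_iff : ∀ x y, x = y ↔ d x y = 0
  triangle : ∀ x y z, d x z ≤ d x y + d y z

/-- A Markov decision process with state space `S` and action space `A`. The discrete case is the
one where both carry the discrete `σ`-algebra. -/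
structure MDP (S A : Type*) [MeasurableSpace S] [MeasurableSpace A] where
  reward : S × A → ℝ
  measurable_reward : Measurable reward
  transition : Kernel (S × A) S
  isMarkov_transition : IsMarkovKernel transition
  discount : ℝ
  discount_pos : 0 < discount
  discount_lt_one : discount < 1

/-- A (randomized, Markovian) stationary policy: each state is sent to a distribution over
actions. -/
structure StationaryPolicy (S A : Type*) [MeasurableSpace S] [MeasurableSpace A] where
  kernel : Kernel S A
  isMarkov_kernel : IsMarkovKernel kernel

/-- `γ ^ c` for a cost `c ∈ [0, ∞]`, with `γ ^ ∞ = 0`. -/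
noncomputable def powCost (γ : ℝ) (c : ℝ≥0∞) : ℝ≥0∞ :=
  if c = ∞ then 0 else ENNReal.ofReal (γ ^ c.toReal)

/-- `log_γ m ∈ [0, ∞]` for `0 < γ < 1` and `m ∈ [0, 1]`, with `log_γ 0 = ∞`. -/
noncomputable def logBase (γ : ℝ) (m : ℝ≥0∞) : ℝ≥0∞ :=
  if m = 0 then ∞ else ENNReal.ofReal (Real.logb γ m.toReal)

namespace MDP

variable {S A : Type*} [MeasurableSpace S] [MeasurableSpace A]

attribute [instance] MDP.isMarkov_transition StationaryPolicy.isMarkov_kernel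

/-- One step of the process of state-action pairs under `π`: from `(s, a)`, the next state is
drawn from `transition (s, a)`, and the next action from `π` at that next state. -/
noncomputable def stepKernel (M : MDP S A) (π : StationaryPolicy S A) :
    Kernel (S × A) (S × A) :=
  M.transition ⊗ₖ Kernel.prodMkLeft (S × A) π.kernel

instance (M : MDP S A) (π : StationaryPolicy S A) : IsMarkovKernel (M.stepKernel π) := by
  unfold stepKernel; infer_instance

/-- The step kernel as a function of the whole history up to time `n`; only the last
state-action pair is used. -/
noncomputable def historyKernel (M : MDP S A) (π : StationaryPolicy S A) (n : ℕ) :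
    Kernel ((i : Finset.Iic n) → (fun _ : ℕ => S × A) i) (S × A) :=
  (M.stepKernel π).comap (fun h => h ⟨n, Finset.mem_Iic.2 le_rfl⟩) (measurable_pi_apply _)

instance (M : MDP S A) (π : StationaryPolicy S A) (n : ℕ) :
    IsMarkovKernel (M.historyKernel π n) := by
  unfold historyKernel; infer_instance

/-- The law of the first state-action pair: from a state `s` the action is drawn from the policy,
from a pair `(s, a)` it is `a`. -/
noncomputable def initialLaw (π : StationaryPolicy S A) : S ⊕ (S × A) → Measure (S × A)
  | .inl s => (π.kernel s).map (fun a => (s, a))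
  | .inr q => Measure.dirac q

instance (π : StationaryPolicy S A) (x : S ⊕ (S × A)) :
    IsProbabilityMeasure (initialLaw π x) := by
  cases x with
  | inl s => exact Measure.isProbabilityMeasure_map measurable_prodMk_left.aemeasurable
  | inr q => unfold initialLaw; infer_instance

/-- The law of the trajectory from `x` under `π`, as a sequence of state-action pairs indexed from
`0`. The rewards are the values of `reward` along it. -/
noncomputable def trajectoryLaw (M : MDP S A) (π : StationaryPolicy S A) (x : S ⊕ (S × A)) :
    Measure (ℕ → S × A) :=
  Kernel.trajMeasure (X := fun _ => S × A) (initialLaw π x) (M.historyKernel π)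

/-- `Reached x y ω t`: on the trajectory `ω` from `x`, the goal `y` has been reached before the
cost of step `t` is incurred. A state is reached when the trajectory visits it. A pair `(s, a)` is
reached once `a` has been performed in `s`, so the cost of that step still counts. A trajectory
from a pair `(s, a)` starts with `a` being performed in `s`: a goal state is then reached at one of
the later times, also if it is `s`. A goal equal to the starting point is reached from the
beginning. -/
def Reached : S ⊕ (S × A) → S ⊕ (S × A) → (ℕ → S × A) → ℕ → Prop
  | .inl _, .inl s', ω, t => ∃ i ≤ t, (ω i).1 = s'
  | .inr _, .inl s', ω, t => ∃ i ≤ t, 1 ≤ i ∧ (ω i).1 = s'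
  | .inl _, .inr q', ω, t => ∃ i < t, ω i = q'
  | .inr q, .inr q', ω, t => q = q' ∨ ∃ i < t, ω i = q'

open Classical in
/-- The total cost (negated reward) from `x` to `y` along the trajectory `ω`. -/
noncomputable def totalCost (M : MDP S A) (x y : S ⊕ (S × A)) (ω : ℕ → S × A) : ℝ≥0∞ :=
  ∑' t, if Reached x y ω t then 0 else ENNReal.ofReal (-M.reward (ω t))

/-- The expected total cost from `x` to `y` under `π`. -/
noncomputable def expectedCost (M : MDP S A) (π : StationaryPolicy S A) (x y : S ⊕ (S × A)) :
    ℝ≥0∞ :=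
  ∫⁻ ω, M.totalCost x y ω ∂(M.trajectoryLaw π x)

/-- The expectation of `γ ^ (total cost from x to y)` under `π`. -/
noncomputable def expectedDiscount (M : MDP S A) (π : StationaryPolicy S A)
    (x y : S ⊕ (S × A)) : ℝ≥0∞ :=
  ∫⁻ ω, powCost M.discount (M.totalCost x y ω) ∂(M.trajectoryLaw π x)

/-- The optimal expected total cost from `x` to `y`. -/
noncomputable def dSum (M : MDP S A) (x y : S ⊕ (S × A)) : ℝ≥0∞ :=
  ⨅ π : StationaryPolicy S A, M.expectedCost π x y

/-- `log_γ` of the optimal expectation of `γ ^ (total cost from x to y)`. -/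
noncomputable def dDisc (M : MDP S A) (x y : S ⊕ (S × A)) : ℝ≥0∞ :=
  logBase M.discount (⨆ π : StationaryPolicy S A, M.expectedDiscount π x y)

/-- The minimum over stationary policies that defines `dSum` exists for all `x, y`. -/
def CostMinAttained (M : MDP S A) : Prop :=
  ∀ x y, ∃ π, ∀ π', M.expectedCost π x y ≤ M.expectedCost π' x y

/-- The maximum over stationary policies that defines `dDisc` exists for all `x, y`. -/
def DiscountMaxAttained (M : MDP S A) : Prop :=
  ∀ x y, ∃ π, ∀ π', M.expectedDiscount π' x y ≤ M.expectedDiscount π x y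

end MDP

/-!
Costs and discounts are treated together. For a one-step cost `c` and a weight `β` on the
continuation, consider the expectation of the sum of the costs until the goal is reached, each
multiplied by the weights of the earlier steps. With `c = -R` and `β = 1` this is the expected total
cost; with `β = γ ^ (-R)` and `c = 1 - β` the sum telescopes, and the expectation is one minus the
expectation of `γ ^ (total cost)` (`goalValue_add_expectedDiscount`). So maximizing the discount is
again minimizing a cost.

For a stationary policy this expectation is the least fixed point of a monotone Bellman operator on
functions `S → [0, ∞]`, and the limit of its iterates from `0` (`lintegral_pathCost`, from the
Markov property of the trajectory). Hence every supersolution `v` of the Bellman equation of `π`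
dominates the value of `π` (`value_le_of_bellman_le`). This carries both main points.

* Triangle inequality (`exists_goalValue_le`). Pursuing `y` with `π₁` and then `z` with `π₂` is not
  stationary. In each state compare its value, computed as if `y` were still to be reached, with the
  value of `π₂` for `z`, and act by the policy that provides the smaller one. The pointwise minimum
  is a supersolution for this stationary policy.
* Attainment (`exists_value_le`). For finite `A`, value iteration converges to a solution of the
  optimality equation, and the policy that is greedy for it has this solution as a supersolution.

If all rewards are negative, the first step from `x` already has positive expected cost whenever the
goal is not `x` (`goalValue_ne_zero`), which separates points once the optimum is attained.
-/

/-! ### Bellman operators for a stationary policy -/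

namespace MDP

variable {S A : Type*} [MeasurableSpace S] [MeasurableSpace A]

/-- The one-step look-ahead of a continuation value `v`: pay `c q`, then receive `v` at the next
state, weighted by `β q`. -/
noncomputable def backup (M : MDP S A) (c β : S × A → ℝ≥0∞) (v : S → ℝ≥0∞) (q : S × A) : ℝ≥0∞ :=
  c q + β q * ∫⁻ s, v s ∂(M.transition q)

/-- The Bellman operator of the policy `π`. -/
noncomputable def bellman (M : MDP S A) (π : StationaryPolicy S A) (c β : S × A → ℝ≥0∞)
    (v : S → ℝ≥0∞) (s : S) : ℝ≥0∞ :=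
  ∫⁻ a, M.backup c β v (s, a) ∂(π.kernel s)

/-- The value function of `π`, as the limit of the finite-horizon values. It is the least fixed
point of the Bellman operator. -/
noncomputable def value (M : MDP S A) (π : StationaryPolicy S A) (c β : S × A → ℝ≥0∞) (s : S) :
    ℝ≥0∞ :=
  ⨆ n : ℕ, (M.bellman π c β)^[n] 0 s

variable {M : MDP S A} {π : StationaryPolicy S A} {c β : S × A → ℝ≥0∞}

lemma backup_mono : Monotone (M.backup c β) := by
  intro v w h q
  unfold backup
  gcongr
  exact h _

lemma bellman_mono : Monotone (M.bellman π c β) := by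
  intro v w h s
  exact lintegral_mono fun a => backup_mono h _

lemma measurable_backup (hc : Measurable c) (hβ : Measurable β) {v : S → ℝ≥0∞}
    (hv : Measurable v) : Measurable (M.backup c β v) :=
  hc.add (hβ.mul hv.lintegral_kernel)

lemma measurable_bellman (hc : Measurable c) (hβ : Measurable β) {v : S → ℝ≥0∞}
    (hv : Measurable v) : Measurable (M.bellman π c β v) :=
  (measurable_backup hc hβ hv).lintegral_kernel_prod_right'

lemma measurable_bellman_iterate (hc : Measurable c) (hβ : Measurable β) (n : ℕ) :
    Measurable ((M.bellman π c β)^[n] 0) := by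
  induction n with
  | zero => exact measurable_const
  | succ n ih =>
    rw [Function.iterate_succ_apply']
    exact measurable_bellman hc hβ ih

lemma measurable_value (hc : Measurable c) (hβ : Measurable β) :
    Measurable (M.value π c β) :=
  Measurable.iSup fun n => measurable_bellman_iterate hc hβ n

/-- Monotone convergence for the one-step look-ahead. -/
lemma backup_iSup {v : ℕ → S → ℝ≥0∞} (hv : ∀ n, Measurable (v n)) (hmono : Monotone v)
    (q : S × A) : M.backup c β (fun s => ⨆ n, v n s) q = ⨆ n, M.backup c β (v n) q := by
  unfold backup
  rw [lintegral_iSup hv hmono, ENNReal.mul_iSup, ENNReal.add_iSup]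

lemma monotone_bellman_iterate : Monotone fun n => (M.bellman π c β)^[n] 0 :=
  bellman_mono.monotone_iterate_of_le_map (fun _ => zero_le)

lemma backup_value (hc : Measurable c) (hβ : Measurable β) (q : S × A) :
    M.backup c β (M.value π c β) q = ⨆ n : ℕ, M.backup c β ((M.bellman π c β)^[n] 0) q :=
  backup_iSup (measurable_bellman_iterate hc hβ) monotone_bellman_iterate q

lemma bellman_value (hc : Measurable c) (hβ : Measurable β) :
    M.bellman π c β (M.value π c β) = M.value π c β := by
  ext s
  unfold bellman
  simp_rw [backup_value hc hβ]
  rw [lintegral_iSup (f := fun n a => M.backup c β ((M.bellman π c β)^[n] 0) (s, a))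
    (fun n => (measurable_backup hc hβ (measurable_bellman_iterate hc hβ n)).comp
      measurable_prodMk_left)
    (fun n m hnm a => backup_mono (monotone_bellman_iterate hnm) _)]
  have h0 : (⨆ n : ℕ, (M.bellman π c β)^[n] 0 s) = ⨆ n : ℕ, (M.bellman π c β)^[n + 1] 0 s :=
    (Monotone.iSup_nat_add (f := fun n => (M.bellman π c β)^[n] 0 s)
      (fun n m hnm => monotone_bellman_iterate hnm s) 1).symm
  rw [value, h0]
  simp_rw [Function.iterate_succ_apply']
  rfl

/-- Any supersolution of the Bellman equation dominates the value function. -/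
lemma value_le_of_bellman_le {v : S → ℝ≥0∞} (h : M.bellman π c β v ≤ v) :
    M.value π c β ≤ v := by
  intro s
  refine iSup_le fun n => ?_
  have : (M.bellman π c β)^[n] 0 ≤ v := by
    induction n with
    | zero => exact fun _ => zero_le
    | succ n ih =>
      rw [Function.iterate_succ_apply']
      exact (bellman_mono ih).trans h
  exact this s

/-! ### Reaching a goal -/

open Classical in
/-- The cost `c`, waived in the goal state. -/
noncomputable def goalCost (c : S × A → ℝ≥0∞) (y : S ⊕ (S × A)) (q : S × A) : ℝ≥0∞ :=
  if .inl q.1 = y then 0 else c q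

open Classical in
/-- The weight `β` of the continuation, set to zero in the goal state and after the goal pair. -/
noncomputable def goalWeight (β : S × A → ℝ≥0∞) (y : S ⊕ (S × A)) (q : S × A) : ℝ≥0∞ :=
  if .inl q.1 = y ∨ .inr q = y then 0 else β q

open Classical in
/-- The value of `π` for the goal `y` from a starting point `x`. If `x` is a pair other than `y`,
its action is performed first, and its cost counts whatever the goal is. -/
noncomputable def goalValue (M : MDP S A) (π : StationaryPolicy S A) (c β : S × A → ℝ≥0∞)
    (x y : S ⊕ (S × A)) : ℝ≥0∞ :=
  match x with
  | .inl s => M.value π (goalCost c y) (goalWeight β y) s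
  | .inr q => if .inr q = y then 0 else
      M.backup c β (M.value π (goalCost c y) (goalWeight β y)) q

variable {y : S ⊕ (S × A)}

lemma backup_goal_le (v : S → ℝ≥0∞) (q : S × A) :
    M.backup (goalCost c y) (goalWeight β y) v q ≤ M.backup c β v q := by
  unfold backup
  gcongr
  · unfold goalCost; split_ifs <;> simp
  · unfold goalWeight; split_ifs <;> simp

lemma measurableSet_inl_fst_eq [MeasurableSingletonClass S] (y : S ⊕ (S × A)) :
    MeasurableSet {q : S × A | Sum.inl q.1 = y} := by
  cases y with
  | inl s =>
    simp only [Sum.inl.injEq]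
    exact measurable_fst (measurableSet_singleton s)
  | inr q => simp

lemma measurable_goalCost [MeasurableSingletonClass S] (hc : Measurable c) (y : S ⊕ (S × A)) :
    Measurable (goalCost c y) :=
  Measurable.ite (measurableSet_inl_fst_eq y) measurable_const hc

section Singleton

variable [MeasurableSingletonClass S] [MeasurableSingletonClass A]

lemma measurableSet_inr_eq (y : S ⊕ (S × A)) :
    MeasurableSet {q : S × A | Sum.inr q = y} := by
  cases y with
  | inl s => simp
  | inr q => simp

lemma measurable_goalWeight (hβ : Measurable β) (y : S ⊕ (S × A)) :
    Measurable (goalWeight β y) :=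
  Measurable.ite ((measurableSet_inl_fst_eq y).union (measurableSet_inr_eq y)) measurable_const hβ

lemma measurable_goal_value (hc : Measurable c) (hβ : Measurable β) (y : S ⊕ (S × A)) :
    Measurable (M.value π (goalCost c y) (goalWeight β y)) :=
  measurable_value (measurable_goalCost hc y) (measurable_goalWeight hβ y)

lemma goalValue_self (hc : Measurable c) (hβ : Measurable β) (x : S ⊕ (S × A)) :
    M.goalValue π c β x x = 0 := by
  cases x with
  | inl s =>
    change M.value _ _ _ s = 0
    rw [← bellman_value (measurable_goalCost hc _) (measurable_goalWeight hβ _)]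
    simp [bellman, backup, goalCost, goalWeight]
  | inr q => simp [goalValue]

/-- A policy that pursues `y` first and `z` afterwards needs no memory: take the better of
`w + κ * (value of π₁ for y)` and `(value of π₂ for z)` in each state, and act by the policy that
provides it. This minimum is a supersolution for the combined stationary policy. Here `w` is the
value of `π₂` from `y`, and the map `t ↦ w + κ * t` describes how the value of reaching `y` and
that of continuing from `y` combine. -/
lemma exists_goalValue_le (hc : Measurable c) (hβ : Measurable β) (π₁ π₂ : StationaryPolicy S A)
    {y z : S ⊕ (S × A)} (hyz : y ≠ z) (κ : ℝ≥0∞)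
    (hκ : ∀ q, c q + β q * M.goalValue π₂ c β y z ≤ M.goalValue π₂ c β y z + κ * c q) :
    ∃ π : StationaryPolicy S A, ∀ x,
      M.goalValue π c β x z ≤ M.goalValue π₂ c β y z + κ * M.goalValue π₁ c β x y := by
  set w := M.goalValue π₂ c β y z with hw
  set V := M.value π₁ (goalCost c y) (goalWeight β y) with hV
  set W := M.value π₂ (goalCost c z) (goalWeight β z) with hW
  have hVm : Measurable V := measurable_goal_value hc hβ y
  have hWm : Measurable W := measurable_goal_value hc hβ z
  set U : S → ℝ≥0∞ := fun s => w + κ * V s with hU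
  have hUm : Measurable U := (hVm.const_mul κ).const_add w
  set v : S → ℝ≥0∞ := fun s => min (U s) (W s) with hv
  have hE : MeasurableSet {s | U s < W s} := measurableSet_lt hUm hWm
  classical
  let π : StationaryPolicy S A :=
    ⟨Kernel.piecewise hE π₁.kernel π₂.kernel, inferInstance⟩
  -- After the goal pair `y` only the value of `π₂` matters, so the look-ahead is at most `w`.
  have hwy : ∀ q, .inr q = y → M.backup c β v q ≤ w := by
    rintro q rfl
    rw [hw, goalValue, if_neg hyz]
    exact backup_mono (fun s => min_le_right _ _) q
  have hstep : ∀ q, M.backup c β v q ≤ w + κ * M.backup c β V q := by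
    intro q
    calc M.backup c β v q ≤ M.backup c β U q := backup_mono (fun s => min_le_left _ _) q
      _ = (c q + β q * w) + κ * (β q * ∫⁻ s, V s ∂M.transition q) := by
        simp only [backup, hU]
        rw [lintegral_add_left measurable_const, lintegral_const_mul _ hVm, lintegral_const,
          measure_univ]
        ring
      _ ≤ (w + κ * c q) + κ * (β q * ∫⁻ s, V s ∂M.transition q) := by
        gcongr ?_ + _
        exact hκ q
      _ = w + κ * M.backup c β V q := by unfold backup; ring
  have hsuper : M.bellman π (goalCost c z) (goalWeight β z) v ≤ v := by
    intro s
    by_cases hs : U s < W s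
    · -- In the goal state `y` itself `U` equals `W`, so `π₁` is never followed there.
      have hy : .inl s ≠ y := by
        rintro rfl
        have h0 : V s = 0 := goalValue_self (M := M) (π := π₁) hc hβ (.inl s)
        simp only [hU, h0, mul_zero, add_zero] at hs
        exact lt_irrefl _ hs
      have hvs : v s = U s := min_eq_left hs.le
      have hVs : V s = ∫⁻ a, M.backup (goalCost c y) (goalWeight β y) V (s, a) ∂π₁.kernel s :=
        (congrFun (bellman_value (measurable_goalCost hc y) (measurable_goalWeight hβ y)) s).symm
      have hm : Measurable fun a => M.backup (goalCost c y) (goalWeight β y) V (s, a) :=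
        (measurable_backup (measurable_goalCost hc y) (measurable_goalWeight hβ y) hVm).comp
          measurable_prodMk_left
      calc M.bellman π (goalCost c z) (goalWeight β z) v s
          = ∫⁻ a, M.backup (goalCost c z) (goalWeight β z) v (s, a) ∂π₁.kernel s := by
            simp only [bellman, π, Kernel.piecewise_apply, Set.mem_ofPred_eq, hs, if_true]
        _ ≤ ∫⁻ a, (w + κ * M.backup (goalCost c y) (goalWeight β y) V (s, a)) ∂π₁.kernel s := by
            refine lintegral_mono fun a => (backup_goal_le v (s, a)).trans ?_
            by_cases hya : .inr (s, a) = y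
            · exact (hwy _ hya).trans le_self_add
            · refine (hstep (s, a)).trans_eq ?_
              simp [backup, goalCost, goalWeight, hy, hya]
        _ = w + κ * V s := by
            rw [lintegral_add_left measurable_const, lintegral_const_mul _ hm, ← hVs,
              lintegral_const, measure_univ, mul_one]
        _ = v s := hvs.symm
    · have hvs : v s = W s := min_eq_right (not_lt.1 hs)
      calc M.bellman π (goalCost c z) (goalWeight β z) v s
          = M.bellman π₂ (goalCost c z) (goalWeight β z) v s := by
            simp only [bellman, π, Kernel.piecewise_apply, Set.mem_ofPred_eq, hs, if_false]
        _ ≤ M.bellman π₂ (goalCost c z) (goalWeight β z) W s :=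
            bellman_mono (fun s => min_le_right _ _) s
        _ = v s := by
            rw [bellman_value (measurable_goalCost hc z) (measurable_goalWeight hβ z), hvs]
  have hle : M.value π (goalCost c z) (goalWeight β z) ≤ v := value_le_of_bellman_le hsuper
  refine ⟨π, fun x => ?_⟩
  cases x with
  | inl s => exact (hle s).trans (min_le_left _ _)
  | inr q =>
    by_cases hz : .inr q = z
    · simp [goalValue, hz]
    · have h1 : M.goalValue π c β (.inr q) z ≤ M.backup c β v q := by
        rw [goalValue, if_neg hz]
        exact backup_mono hle q
      by_cases hy : .inr q = y
      · exact (h1.trans (hwy q hy)).trans le_self_add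
      · refine (h1.trans (hstep q)).trans_eq ?_
        rw [goalValue, if_neg hy]

/-- With positive costs, a goal other than the starting point has positive value. -/
lemma goalValue_ne_zero (hc : Measurable c) (hβ : Measurable β) (hpos : ∀ q, 0 < c q)
    {x y : S ⊕ (S × A)} (hxy : x ≠ y) : M.goalValue π c β x y ≠ 0 := by
  cases x with
  | inl s =>
    change M.value _ _ _ s ≠ 0
    rw [← bellman_value (measurable_goalCost hc _) (measurable_goalWeight hβ _)]
    have hm := (measurable_backup (M := M) (measurable_goalCost hc y) (measurable_goalWeight hβ y)
      (measurable_goal_value (M := M) (π := π) hc hβ y)).comp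
          (measurable_prodMk_left (x := s))
    intro h
    have hae := (lintegral_eq_zero_iff hm).1 h
    obtain ⟨a, ha⟩ := hae.exists
    have : c (s, a) = 0 := by
      simp only [Function.comp_apply, backup, goalCost, hxy, if_false, Pi.zero_apply] at ha
      exact (add_eq_zero.1 ha).1
    exact (hpos _).ne' this
  | inr q =>
    rw [goalValue, if_neg hxy, backup]
    exact (add_pos_of_pos_of_nonneg (hpos q) zero_le).ne'

end Singleton

/-! ### Optimal policies for finitely many actions -/

/-- The minimizer with the least index in an enumeration of `A` depends measurably on the state. -/
lemma exists_measurable_argmin [Finite A] [MeasurableSingletonClass A] [Nonempty A]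
    {f : S × A → ℝ≥0∞} (hf : Measurable f) :
    ∃ g : S → A, Measurable g ∧ ∀ s a, f (s, g s) ≤ f (s, a) := by
  classical
  obtain ⟨e⟩ := Finite.exists_equiv_fin A |>.choose_spec
  have hp : ∀ s, ∃ k : ℕ, ∃ a : A, (e a : ℕ) = k ∧ ∀ b, f (s, a) ≤ f (s, b) := by
    intro s
    obtain ⟨a, ha⟩ := Finite.exists_min fun a => f (s, a)
    exact ⟨e a, a, rfl, ha⟩
  have hm : ∀ k : ℕ, MeasurableSet
      {s | ∃ a : A, (e a : ℕ) = k ∧ ∀ b, f (s, a) ≤ f (s, b)} := by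
    intro k
    have : {s | ∃ a : A, (e a : ℕ) = k ∧ ∀ b, f (s, a) ≤ f (s, b)} =
        ⋃ a : A, ⋃ _ : (e a : ℕ) = k, ⋂ b : A, {s | f (s, a) ≤ f (s, b)} := by
      ext s; simp
    rw [this]
    refine MeasurableSet.iUnion fun a => MeasurableSet.iUnion fun _ => MeasurableSet.iInter fun b =>
      measurableSet_le (hf.comp measurable_prodMk_right) (hf.comp measurable_prodMk_right)
  let d : ℕ → A := fun k => if h : ∃ a : A, (e a : ℕ) = k then h.choose else Classical.arbitrary A
  have hd : ∀ a, d (e a) = a := by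
    intro a
    have h : ∃ b : A, (e b : ℕ) = (e a : ℕ) := ⟨a, rfl⟩
    simp only [d, dif_pos h]
    exact e.injective (Fin.ext h.choose_spec)
  refine ⟨fun s => d (Nat.find (hp s)), (measurable_from_nat (f := d)).comp (measurable_find hp hm),
    fun s a => ?_⟩
  obtain ⟨b, hb, hmin⟩ := Nat.find_spec (hp s)
  simp only [← hb, hd]
  exact hmin a

/-- Value iteration: if there are finitely many actions, the limit of the optimal finite-horizon
values solves the optimality equation, because finite minima commute with increasing limits, and
a policy that is greedy for it attains it. -/
lemma exists_value_le [Finite A] [MeasurableSingletonClass A] [Nonempty A]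
    (M : MDP S A) (hc : Measurable c) (hβ : Measurable β) :
    ∃ π : StationaryPolicy S A, ∀ π', M.value π c β ≤ M.value π' c β := by
  set T : (S → ℝ≥0∞) → S → ℝ≥0∞ := fun v s => ⨅ a, M.backup c β v (s, a) with hT
  have hTmono : Monotone T := fun v w h s => iInf_mono fun a => backup_mono h _
  have hTm : ∀ n, Measurable (T^[n] 0) := by
    intro n
    induction n with
    | zero => exact measurable_const
    | succ n ih =>
      rw [Function.iterate_succ_apply']
      exact Measurable.iInf fun a => (measurable_backup hc hβ ih).comp measurable_prodMk_right
  have hmono : Monotone fun n => T^[n] 0 :=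
    hTmono.monotone_iterate_of_le_map (fun _ => zero_le)
  set v : S → ℝ≥0∞ := fun s => ⨆ n : ℕ, T^[n] 0 s with hv
  have hTv : T v ≤ v := by
    intro s
    have h : T v s = ⨅ a, ⨆ n, M.backup c β (T^[n] 0) (s, a) :=
      iInf_congr fun a => backup_iSup hTm hmono (s, a)
    rw [h, ← iSup_iInf_of_monotone (f := fun a n => M.backup c β (T^[n] 0) (s, a))
      (fun a n m hnm => backup_mono (hmono hnm) _)]
    refine iSup_le fun n => le_iSup_of_le (n + 1) ?_
    rw [Function.iterate_succ_apply']
  obtain ⟨g, hg, hmin⟩ := exists_measurable_argmin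
    (measurable_backup (M := M) hc hβ (Measurable.iSup hTm : Measurable v))
  refine ⟨⟨Kernel.deterministic g hg, inferInstance⟩, fun π' => ?_⟩
  refine (value_le_of_bellman_le (v := v) fun s => ?_).trans fun s => iSup_mono fun n => ?_
  · refine le_trans ?_ (hTv s)
    rw [bellman, Kernel.lintegral_deterministic' (f := fun a => M.backup c β v (s, a)) hg
      ((measurable_backup hc hβ (Measurable.iSup hTm : Measurable v)).comp measurable_prodMk_left)]
    exact le_iInf fun a => hmin s a
  · have : T^[n] 0 ≤ (M.bellman π' c β)^[n] 0 := by
      induction n with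
      | zero => exact le_rfl
      | succ n ih =>
        rw [Function.iterate_succ_apply', Function.iterate_succ_apply']
        refine (hTmono ih).trans fun s => ?_
        calc T ((M.bellman π' c β)^[n] 0) s
            = ∫⁻ _, T ((M.bellman π' c β)^[n] 0) s ∂π'.kernel s := by simp
          _ ≤ _ := lintegral_mono fun a => iInf_le _ a
    exact this s

lemma exists_goalValue_isMin [Finite A] [MeasurableSingletonClass S] [MeasurableSingletonClass A]
    [Nonempty A] (M : MDP S A) (hc : Measurable c) (hβ : Measurable β) (x y : S ⊕ (S × A)) :
    ∃ π : StationaryPolicy S A, ∀ π', M.goalValue π c β x y ≤ M.goalValue π' c β x y := by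
  obtain ⟨π, hπ⟩ := M.exists_value_le (measurable_goalCost hc y) (measurable_goalWeight hβ y)
  refine ⟨π, fun π' => ?_⟩
  cases x with
  | inl s => exact hπ π' s
  | inr q =>
    simp only [goalValue]
    split_ifs
    · exact le_rfl
    · exact backup_mono (hπ π') q

end MDP

/-! ### The total cost as a weighted sum -/

namespace MDP

variable {S A : Type*} {c β : S × A → ℝ≥0∞}

/-- On the trajectory from `x`, being in the pair `p` at time `i` means that the goal `y` is
reached before the cost of step `i`. A trajectory from a pair has reached its goal at time `0`
only if the goal is that pair. -/
def StopBefore (x y : S ⊕ (S × A)) (i : ℕ) (p : S × A) : Prop :=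
  match x, i with
  | .inr q, 0 => .inr q = y
  | _, _ => .inl p.1 = y

lemma stopBefore_inl (s : S) (y : S ⊕ (S × A)) (i : ℕ) (p : S × A) :
    StopBefore (.inl s) y i p ↔ .inl p.1 = y := Iff.rfl

lemma stopBefore_succ (x y : S ⊕ (S × A)) (i : ℕ) (p : S × A) :
    StopBefore x y (i + 1) p ↔ .inl p.1 = y := by
  cases x <;> exact Iff.rfl

lemma stopBefore_inr_zero (q : S × A) (y : S ⊕ (S × A)) (p : S × A) :
    StopBefore (.inr q) y 0 p ↔ .inr q = y := Iff.rfl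

/-- A goal pair stops the trajectory one step later than a goal state: the cost of performing it
still counts. -/
lemma reached_iff (x y : S ⊕ (S × A)) (ω : ℕ → S × A) (t : ℕ) :
    Reached x y ω t ↔
      (∃ i < t, StopBefore x y i (ω i) ∨ .inr (ω i) = y) ∨ StopBefore x y t (ω t) := by
  have hle : ∀ p : ℕ → Prop, (∃ i ≤ t, p i) ↔ (∃ i < t, p i) ∨ p t := by
    intro p
    simp only [Nat.le_iff_lt_or_eq, or_and_right, exists_or, exists_eq_left]
  rcases x with s | q <;> rcases y with s' | q'
  · simp [Reached, StopBefore, hle]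
  · simp [Reached, StopBefore]
  · have h : ∀ i, StopBefore (.inr q) (.inl s') i (ω i) ↔ 1 ≤ i ∧ (ω i).1 = s' := by
      intro i
      cases i <;> simp [StopBefore]
    simp [Reached, h, hle]
  · cases t with
    | zero => simp [Reached, StopBefore]
    | succ t =>
      have h : (∃ i < t + 1, StopBefore (.inr q) (.inr q') i (ω i)) ↔ q = q' := by
        constructor
        · rintro ⟨i, -, hi⟩
          cases i with
          | zero => exact Sum.inr_injective hi
          | succ i => exact absurd hi Sum.inl_ne_inr
        · rintro rfl
          exact ⟨0, Nat.succ_pos t, rfl⟩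
      simp only [and_or_left, exists_or, h]
      simp [Reached, StopBefore]

lemma Reached.mono {x y : S ⊕ (S × A)} {ω : ℕ → S × A} {i t : ℕ} (hit : i ≤ t)
    (h : Reached x y ω i) : Reached x y ω t := by
  rw [reached_iff] at h ⊢
  rcases hit.eq_or_lt with rfl | hlt
  · exact h
  · rcases h with ⟨j, hj, h⟩ | h
    · exact Or.inl ⟨j, hj.trans hlt, h⟩
    · exact Or.inl ⟨i, hlt, Or.inl h⟩

open Classical in
/-- The sum, along the trajectory `ω` from `x` and until the goal `y` is reached, of the costs `c`,
each multiplied by the weights `β` of the earlier steps. -/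
noncomputable def pathCost (c β : S × A → ℝ≥0∞) (x y : S ⊕ (S × A)) (ω : ℕ → S × A) : ℝ≥0∞ :=
  ∑' t, if Reached x y ω t then 0 else (∏ i ∈ Finset.range t, β (ω i)) * c (ω t)

open Classical in
/-- The cost of step `t`, waived if the goal has been reached. -/
noncomputable def timeCost (c : S × A → ℝ≥0∞) (x y : S ⊕ (S × A)) (t : ℕ) (p : S × A) : ℝ≥0∞ :=
  if StopBefore x y t p then 0 else c p

open Classical in
/-- The weight of step `t`, set to zero if the goal has been reached after that step. -/
noncomputable def timeWeight (β : S × A → ℝ≥0∞) (x y : S ⊕ (S × A)) (t : ℕ) (p : S × A) :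
    ℝ≥0∞ :=
  if StopBefore x y t p ∨ .inr p = y then 0 else β p

lemma pathCost_eq (x y : S ⊕ (S × A)) (ω : ℕ → S × A) :
    pathCost c β x y ω =
      ∑' t, (∏ i ∈ Finset.range t, timeWeight β x y i (ω i)) * timeCost c x y t (ω t) := by
  refine tsum_congr fun t => ?_
  rw [reached_iff]
  split_ifs with h
  · symm
    rcases h with ⟨i, hi, h⟩ | h
    · rw [Finset.prod_eq_zero (Finset.mem_range.2 hi) (by simp [timeWeight, h]), zero_mul]
    · simp [timeCost, h]
  · push Not at h
    have h2 : timeCost c x y t (ω t) = c (ω t) := by simp [timeCost, h.2]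
    rw [h2]
    congr 1
    refine Finset.prod_congr rfl fun i hi => ?_
    have := h.1 i (Finset.mem_range.1 hi)
    simp [timeWeight, this.1, this.2]

end MDP

/-! ### Expectations along the trajectory -/

namespace MDP

variable {S A : Type*} [MeasurableSpace S] [MeasurableSpace A]
  {M : MDP S A} {π : StationaryPolicy S A} {c β : S × A → ℝ≥0∞}

instance (M : MDP S A) (π : StationaryPolicy S A) (x : S ⊕ (S × A)) :
    IsProbabilityMeasure (M.trajectoryLaw π x) := by
  unfold trajectoryLaw; infer_instance

lemma map_eval_zero_trajectoryLaw (M : MDP S A) (π : StationaryPolicy S A) (x : S ⊕ (S × A)) :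
    (M.trajectoryLaw π x).map (fun ω => ω 0) = initialLaw π x := by
  have h : (fun ω : ℕ → S × A => ω 0) =
      (fun u : (i : Finset.Iic 0) → S × A => u ⟨0, by simp⟩) ∘
        (Preorder.frestrictLe (π := fun _ : ℕ => S × A) 0) := rfl
  rw [h, ← Measure.map_map (by fun_prop) (by fun_prop), trajectoryLaw, Kernel.trajMeasure,
    Measure.map_comp _ _ (by fun_prop), Kernel.traj_map_frestrictLe, Kernel.partialTraj_self,
    Measure.id_comp, Measure.map_map (by fun_prop) (by fun_prop)]
  convert! Measure.map_id

lemma lintegral_eval_zero (x : S ⊕ (S × A)) {h : S × A → ℝ≥0∞} (hh : Measurable h) :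
    ∫⁻ ω, h (ω 0) ∂M.trajectoryLaw π x = ∫⁻ q, h q ∂initialLaw π x := by
  rw [← map_eval_zero_trajectoryLaw M, lintegral_map hh (measurable_pi_apply 0)]

lemma lintegral_stepKernel {h : S × A → ℝ≥0∞} (hh : Measurable h) (q : S × A) :
    ∫⁻ p, h p ∂M.stepKernel π q = ∫⁻ s, ∫⁻ a, h (s, a) ∂π.kernel s ∂M.transition q := by
  rw [stepKernel, Kernel.lintegral_compProd _ _ _ hh]
  simp

/-- The Markov property, for products of functions of the single steps. -/
lemma lintegral_prod_mul_succ (x : S ⊕ (S × A)) {b : ℕ → S × A → ℝ≥0∞}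
    (hb : ∀ n, Measurable (b n)) {h : S × A → ℝ≥0∞} (hh : Measurable h) (n : ℕ) :
    ∫⁻ ω, (∏ i ∈ Finset.range (n + 1), b i (ω i)) * h (ω (n + 1)) ∂M.trajectoryLaw π x =
      ∫⁻ ω, (∏ i ∈ Finset.range (n + 1), b i (ω i)) * ∫⁻ p, h p ∂M.stepKernel π (ω n)
        ∂M.trajectoryLaw π x := by
  let F : ((i : Finset.Iic n) → S × A) → ℝ≥0∞ := fun u => ∏ i : Finset.Iic n, b i (u i)
  have hF : Measurable F := Finset.measurable_prod _ fun i _ => (hb i).comp (measurable_pi_apply i)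
  have hFω : ∀ ω : ℕ → S × A, ∏ i ∈ Finset.range (n + 1), b i (ω i) =
      F (Preorder.frestrictLe (π := fun _ : ℕ => S × A) n ω) := by
    intro ω
    rw [Nat.range_succ_eq_Iic, ← Finset.prod_coe_sort]
    rfl
  have key := Kernel.map_frestrictLe_trajMeasure_compProd_eq_map_trajMeasure
    (X := fun _ => S × A) (μ₀ := initialLaw π x) (κ := M.historyKernel π) (a := n)
  have hprob : IsProbabilityMeasure ((M.trajectoryLaw π x).map
      (Preorder.frestrictLe (π := fun _ : ℕ => S × A) n)) :=
    Measure.isProbabilityMeasure_map (by fun_prop)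
  have hG : Measurable fun p : ((i : Finset.Iic n) → S × A) × (S × A) => F p.1 * h p.2 :=
    (hF.comp measurable_fst).mul (hh.comp measurable_snd)
  have hK : Measurable fun u : (i : Finset.Iic n) → S × A =>
      ∫⁻ p, h p ∂M.historyKernel π n u := hh.lintegral_kernel
  simp_rw [hFω]
  calc ∫⁻ ω, F (Preorder.frestrictLe (π := fun _ : ℕ => S × A) n ω) * h (ω (n + 1))
        ∂M.trajectoryLaw π x
      = ∫⁻ p, F p.1 * h p.2 ∂((M.trajectoryLaw π x).map
          (fun ω => (Preorder.frestrictLe (π := fun _ : ℕ => S × A) n ω, ω (n + 1)))) := by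
        rw [lintegral_map hG (by fun_prop)]
    _ = ∫⁻ p, F p.1 * h p.2 ∂(((M.trajectoryLaw π x).map
          (Preorder.frestrictLe (π := fun _ : ℕ => S × A) n)) ⊗ₘ M.historyKernel π n) := by
        rw [trajectoryLaw, key]
    _ = ∫⁻ u, F u * ∫⁻ p, h p ∂M.historyKernel π n u ∂((M.trajectoryLaw π x).map
          (Preorder.frestrictLe (π := fun _ : ℕ => S × A) n)) := by
        rw [Measure.lintegral_compProd hG]
        simp_rw [lintegral_const_mul _ hh]
    _ = _ := by
        rw [lintegral_map (f := fun u => F u * ∫⁻ p, h p ∂M.historyKernel π n u) (hF.mul hK)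
          (by fun_prop)]
        rfl

/-- The Bellman operator of `π` on functions of state-action pairs. -/
noncomputable def pairStep (M : MDP S A) (π : StationaryPolicy S A) (c b h : S × A → ℝ≥0∞)
    (q : S × A) : ℝ≥0∞ :=
  c q + b q * ∫⁻ p, h p ∂M.stepKernel π q

lemma measurable_pairStep {c b h : S × A → ℝ≥0∞} (hc : Measurable c) (hb : Measurable b)
    (hh : Measurable h) : Measurable (M.pairStep π c b h) :=
  hc.add (hb.mul hh.lintegral_kernel)

lemma pairStep_eq_backup {c b h : S × A → ℝ≥0∞} (hh : Measurable h) :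
    M.pairStep π c b h = M.backup c b (fun s => ∫⁻ a, h (s, a) ∂π.kernel s) := by
  ext q
  rw [pairStep, lintegral_stepKernel hh, backup]

lemma measurable_pairStep_iterate {c b : S × A → ℝ≥0∞} (hc : Measurable c) (hb : Measurable b)
    (n : ℕ) : Measurable ((M.pairStep π c b)^[n] 0) := by
  induction n with
  | zero => exact measurable_const
  | succ n ih =>
    rw [Function.iterate_succ_apply']
    exact measurable_pairStep hc hb ih

lemma lintegral_pairStep_iterate {c b : S × A → ℝ≥0∞} (hc : Measurable c) (hb : Measurable b)
    (n : ℕ) : (fun s => ∫⁻ a, (M.pairStep π c b)^[n] 0 (s, a) ∂π.kernel s) =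
      (M.bellman π c b)^[n] 0 := by
  induction n with
  | zero => ext s; simp
  | succ n ih =>
    rw [Function.iterate_succ_apply', Function.iterate_succ_apply',
      pairStep_eq_backup (measurable_pairStep_iterate hc hb n), ih]
    rfl

section WeightedSum

variable {c b : ℕ → S × A → ℝ≥0∞}

/-- The finite-horizon expectation with terminal value `h`, evaluated by backward induction. -/
noncomputable def backwardValue (M : MDP S A) (π : StationaryPolicy S A)
    (c b : ℕ → S × A → ℝ≥0∞) : ℕ → (S × A → ℝ≥0∞) → S × A → ℝ≥0∞
  | 0, h => h
  | n + 1, h => M.backwardValue π c b n (M.pairStep π (c n) (b n) h)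

lemma measurable_prod_range (hb : ∀ n, Measurable (b n)) (n : ℕ) :
    Measurable fun ω : ℕ → S × A => ∏ i ∈ Finset.range n, b i (ω i) :=
  Finset.measurable_prod _ fun i _ => (hb i).comp (measurable_pi_apply i)

lemma measurable_weighted_term (hc : ∀ n, Measurable (c n)) (hb : ∀ n, Measurable (b n)) (n : ℕ) :
    Measurable fun ω : ℕ → S × A => (∏ i ∈ Finset.range n, b i (ω i)) * c n (ω n) :=
  (measurable_prod_range hb n).mul ((hc n).comp (measurable_pi_apply n))

/-- Backward induction: the Markov property moves the terminal value `h` one step back at a time. -/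
lemma lintegral_weighted_sum_add (hc : ∀ n, Measurable (c n)) (hb : ∀ n, Measurable (b n))
    (x : S ⊕ (S × A)) (n : ℕ) {h : S × A → ℝ≥0∞} (hh : Measurable h) :
    ∫⁻ ω, ((∑ t ∈ Finset.range n, (∏ i ∈ Finset.range t, b i (ω i)) * c t (ω t)) +
        (∏ i ∈ Finset.range n, b i (ω i)) * h (ω n)) ∂M.trajectoryLaw π x =
      ∫⁻ ω, M.backwardValue π c b n h (ω 0) ∂M.trajectoryLaw π x := by
  induction n generalizing h with
  | zero => simp [backwardValue]
  | succ n ih =>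
    rw [backwardValue, ← ih (measurable_pairStep (hc n) (hb n) hh)]
    have hsum : ∀ m, Measurable fun ω : ℕ → S × A =>
        ∑ t ∈ Finset.range m, (∏ i ∈ Finset.range t, b i (ω i)) * c t (ω t) := fun m =>
      Finset.measurable_sum _ fun t _ => measurable_weighted_term hc hb t
    rw [lintegral_add_left (hsum (n + 1)), lintegral_prod_mul_succ x hb hh,
      ← lintegral_add_left (hsum (n + 1))]
    refine lintegral_congr fun ω => ?_
    rw [Finset.sum_range_succ, Finset.prod_range_succ, pairStep]
    ring

/-- The expected weighted sum of costs along the trajectory, where the first step may have its own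
cost and weight. -/
lemma lintegral_tsum_weighted (hc : ∀ n, Measurable (c n)) (hb : ∀ n, Measurable (b n))
    (hc1 : ∀ n, c (n + 1) = c 1) (hb1 : ∀ n, b (n + 1) = b 1) (x : S ⊕ (S × A)) :
    ∫⁻ ω, ∑' t, (∏ i ∈ Finset.range t, b i (ω i)) * c t (ω t) ∂M.trajectoryLaw π x =
      ∫⁻ q, M.backup (c 0) (b 0) (M.value π (c 1) (b 1)) q ∂initialLaw π x := by
  have hback : ∀ n h, M.backwardValue π c b (n + 1) h =
      M.pairStep π (c 0) (b 0) ((M.pairStep π (c 1) (b 1))^[n] h) := by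
    intro n
    induction n with
    | zero => intro h; rfl
    | succ n ih => intro h; rw [backwardValue, ih, hc1 n, hb1 n, Function.iterate_succ_apply]
  have hfin : ∀ n, ∫⁻ ω, (∑ t ∈ Finset.range (n + 1),
      (∏ i ∈ Finset.range t, b i (ω i)) * c t (ω t)) ∂M.trajectoryLaw π x =
        ∫⁻ q, M.backup (c 0) (b 0) ((M.bellman π (c 1) (b 1))^[n] 0) q ∂initialLaw π x := by
    intro n
    have h := lintegral_weighted_sum_add (M := M) (π := π) hc hb x (n + 1)
      (h := 0) measurable_const
    simp only [Pi.zero_apply, mul_zero, add_zero] at h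
    rw [h, hback, lintegral_eval_zero x (measurable_pairStep (hc 0) (hb 0)
      (measurable_pairStep_iterate (hc 1) (hb 1) n)),
      pairStep_eq_backup (measurable_pairStep_iterate (hc 1) (hb 1) n),
      lintegral_pairStep_iterate (hc 1) (hb 1)]
  rw [lintegral_congr fun q => show M.backup (c 0) (b 0) (M.value π (c 1) (b 1)) q =
    ⨆ n : ℕ, M.backup (c 0) (b 0) ((M.bellman π (c 1) (b 1))^[n] 0) q from
    backup_iSup (measurable_bellman_iterate (hc 1) (hb 1)) monotone_bellman_iterate q]
  rw [lintegral_iSup (fun n => measurable_backup (hc 0) (hb 0)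
    (measurable_bellman_iterate (hc 1) (hb 1) n))
    (fun n m hnm => backup_mono (monotone_bellman_iterate hnm))]
  simp_rw [← hfin]
  have hmono : Monotone fun n : ℕ => fun ω : ℕ → S × A =>
      ∑ t ∈ Finset.range (n + 1), (∏ i ∈ Finset.range t, b i (ω i)) * c t (ω t) :=
    fun n m hnm ω => Finset.sum_le_sum_of_subset (Finset.range_mono (by omega))
  rw [← lintegral_iSup (fun n => Finset.measurable_sum _
    fun t _ => measurable_weighted_term hc hb t) hmono]
  refine lintegral_congr fun ω => ?_
  rw [ENNReal.tsum_eq_iSup_nat]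
  exact (Monotone.iSup_nat_add (f := fun n => ∑ t ∈ Finset.range n,
    (∏ i ∈ Finset.range t, b i (ω i)) * c t (ω t))
    (fun n m hnm => Finset.sum_le_sum_of_subset (Finset.range_mono hnm)) 1).symm

end WeightedSum

section Singleton

variable [MeasurableSingletonClass S] [MeasurableSingletonClass A]

lemma measurable_timeCost_weight (hc : Measurable c) (hβ : Measurable β) (x y : S ⊕ (S × A))
    (t : ℕ) : Measurable (timeCost c x y t) ∧ Measurable (timeWeight β x y t) := by
  have h : MeasurableSet {p : S × A | StopBefore x y t p} := by
    rcases x with s | q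
    · exact measurableSet_inl_fst_eq y
    · cases t with
      | zero => exact MeasurableSet.const _
      | succ t => exact measurableSet_inl_fst_eq y
  exact ⟨Measurable.ite h measurable_const hc,
    Measurable.ite (h.union (measurableSet_inr_eq y)) measurable_const hβ⟩

lemma measurable_pathCost (hc : Measurable c) (hβ : Measurable β) (x y : S ⊕ (S × A)) :
    Measurable (pathCost c β x y) := by
  have h : pathCost c β x y = fun ω =>
      ∑' t, (∏ i ∈ Finset.range t, timeWeight β x y i (ω i)) * timeCost c x y t (ω t) :=
    funext (pathCost_eq x y)
  rw [h]
  exact Measurable.tsum fun t => measurable_weighted_term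
    (fun n => (measurable_timeCost_weight hc hβ x y n).1)
    (fun n => (measurable_timeCost_weight hc hβ x y n).2) t

/-- The values computed by the Bellman operator are the expected costs along the trajectory. -/
lemma lintegral_pathCost (hc : Measurable c) (hβ : Measurable β) (x y : S ⊕ (S × A)) :
    ∫⁻ ω, pathCost c β x y ω ∂M.trajectoryLaw π x = M.goalValue π c β x y := by
  classical
  have hsucc : ∀ n, timeCost c x y (n + 1) = goalCost c y ∧
      timeWeight β x y (n + 1) = goalWeight β y := by
    intro n
    constructor <;> ext p <;> simp [timeCost, timeWeight, goalCost, goalWeight, stopBefore_succ]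
  simp_rw [pathCost_eq]
  rw [lintegral_tsum_weighted (fun n => (measurable_timeCost_weight hc hβ x y n).1)
    (fun n => (measurable_timeCost_weight hc hβ x y n).2)
    (fun n => (hsucc n).1.trans (hsucc 0).1.symm) (fun n => (hsucc n).2.trans (hsucc 0).2.symm),
    (hsucc 0).1, (hsucc 0).2]
  have hV := measurable_goal_value (M := M) (π := π) hc hβ y
  have hm := measurable_backup (M := M) (measurable_timeCost_weight hc hβ x y 0).1
    (measurable_timeCost_weight hc hβ x y 0).2 hV
  rcases x with s | q
  · simp only [initialLaw]
    rw [lintegral_map hm measurable_prodMk_left]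
    have h0 : timeCost c (.inl s) y 0 = goalCost c y ∧
        timeWeight β (.inl s) y 0 = goalWeight β y := by
      constructor <;> ext p <;> simp [timeCost, timeWeight, goalCost, goalWeight, stopBefore_inl]
    rw [h0.1, h0.2]
    exact congrFun (bellman_value (measurable_goalCost hc y) (measurable_goalWeight hβ y)) s
  · simp only [initialLaw]
    rw [lintegral_dirac' _ hm]
    by_cases h : .inr q = y
    · subst h
      simp [goalValue, backup, timeCost, timeWeight, stopBefore_inr_zero]
    · simp [goalValue, backup, timeCost, timeWeight, stopBefore_inr_zero, h]

end Singleton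

end MDP

/-! ### The functions `powCost` and `logBase` -/

section PowCost

variable {γ : ℝ}

lemma powCost_zero (γ : ℝ) : powCost γ 0 = 1 := by simp [powCost]

lemma powCost_of_ne_top {a : ℝ≥0∞} (ha : a ≠ ∞) :
    powCost γ a = ENNReal.ofReal (γ ^ a.toReal) := if_neg ha

lemma powCost_add (hγ : 0 < γ) (a b : ℝ≥0∞) :
    powCost γ (a + b) = powCost γ a * powCost γ b := by
  by_cases ha : a = ∞
  · simp [powCost, ha]
  by_cases hb : b = ∞
  · simp [powCost, hb]
  rw [powCost_of_ne_top ha, powCost_of_ne_top hb, powCost_of_ne_top (ENNReal.add_ne_top.2 ⟨ha, hb⟩),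
    ENNReal.toReal_add ha hb, Real.rpow_add hγ, ENNReal.ofReal_mul (Real.rpow_nonneg hγ.le _)]

lemma powCost_sum (hγ : 0 < γ) (f : ℕ → ℝ≥0∞) (n : ℕ) :
    powCost γ (∑ i ∈ Finset.range n, f i) = ∏ i ∈ Finset.range n, powCost γ (f i) := by
  induction n with
  | zero => simp [powCost_zero]
  | succ n ih => rw [Finset.sum_range_succ, Finset.prod_range_succ, powCost_add hγ, ih]

lemma powCost_le_one (hγ : 0 < γ) (hγ1 : γ < 1) (a : ℝ≥0∞) : powCost γ a ≤ 1 := by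
  by_cases ha : a = ∞
  · simp [powCost, ha]
  rw [powCost_of_ne_top ha]
  exact ENNReal.ofReal_le_one.2 (Real.rpow_le_one hγ.le hγ1.le ENNReal.toReal_nonneg)

lemma powCost_lt_one (hγ : 0 < γ) (hγ1 : γ < 1) {a : ℝ≥0∞} (ha : a ≠ 0) : powCost γ a < 1 := by
  by_cases ha' : a = ∞
  · simp [powCost, ha']
  rw [powCost_of_ne_top ha', ENNReal.ofReal_lt_one]
  exact Real.rpow_lt_one hγ.le hγ1 (ENNReal.toReal_pos ha ha')

lemma measurable_powCost (γ : ℝ) : Measurable (powCost γ) :=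
  Measurable.ite (measurableSet_singleton ∞) measurable_const (by fun_prop)

/-- Continuity of `powCost` along sequences of finite costs, also at an infinite limit. -/
lemma tendsto_powCost (hγ : 0 < γ) (hγ1 : γ < 1) {u : ℕ → ℝ≥0∞} (hu : ∀ n, u n ≠ ∞) {L : ℝ≥0∞}
    (h : Filter.Tendsto u Filter.atTop (nhds L)) :
    Filter.Tendsto (fun n => powCost γ (u n)) Filter.atTop (nhds (powCost γ L)) := by
  simp_rw [powCost_of_ne_top (hu _)]
  by_cases hL : L = ∞
  · subst hL
    have h1 : Filter.Tendsto (fun n => (u n).toReal) Filter.atTop Filter.atTop := by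
      refine Filter.tendsto_atTop.2 fun b => ?_
      filter_upwards [h.eventually (lt_mem_nhds (ENNReal.ofReal_lt_top (r := b)))] with n hn
      exact (ENNReal.ofReal_le_iff_le_toReal (hu n)).1 hn.le
    have h2 := (tendsto_rpow_atTop_of_base_lt_one γ (by linarith) hγ1).comp h1
    simpa [powCost] using ENNReal.tendsto_ofReal h2
  · rw [powCost_of_ne_top hL]
    exact ENNReal.tendsto_ofReal (((Real.continuous_const_rpow hγ.ne').tendsto _).comp
      ((ENNReal.tendsto_toReal hL).comp h))

lemma logBase_one (γ : ℝ) : logBase γ 1 = 0 := by simp [logBase]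

lemma logBase_anti (hγ : 0 < γ) (hγ1 : γ < 1) {a b : ℝ≥0∞} (hab : a ≤ b) (hb : b ≤ 1) :
    logBase γ b ≤ logBase γ a := by
  by_cases ha : a = 0
  · simp [logBase, ha]
  have hb0 : b ≠ 0 := fun h => ha (le_zero_iff.1 (h ▸ hab))
  have hbt : b ≠ ∞ := ne_top_of_le_ne_top ENNReal.one_ne_top hb
  have hat : a ≠ ∞ := ne_top_of_le_ne_top hbt hab
  rw [logBase, logBase, if_neg ha, if_neg hb0]
  exact ENNReal.ofReal_le_ofReal ((Real.logb_le_logb_of_base_lt_one hγ hγ1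
    (ENNReal.toReal_pos hb0 hbt) (ENNReal.toReal_pos ha hat)).2 (ENNReal.toReal_mono hbt hab))

lemma logBase_mul (hγ : 0 < γ) (hγ1 : γ < 1) {a b : ℝ≥0∞} (ha1 : a ≤ 1) (hb1 : b ≤ 1) :
    logBase γ (a * b) = logBase γ a + logBase γ b := by
  by_cases ha : a = 0
  · simp [logBase, ha]
  by_cases hb : b = 0
  · simp [logBase, hb]
  have hpos : ∀ {m : ℝ≥0∞}, m ≠ 0 → m ≤ 1 → 0 < m.toReal ∧ m.toReal ≤ 1 := fun h0 h1 =>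
    ⟨ENNReal.toReal_pos h0 (ne_top_of_le_ne_top ENNReal.one_ne_top h1),
      by simpa using ENNReal.toReal_mono ENNReal.one_ne_top h1⟩
  obtain ⟨ha0, ha1⟩ := hpos ha ha1
  obtain ⟨hb0, hb1⟩ := hpos hb hb1
  rw [logBase, logBase, logBase, if_neg ha, if_neg hb, if_neg (mul_ne_zero ha hb),
    ENNReal.toReal_mul, Real.logb_mul ha0.ne' hb0.ne', ENNReal.ofReal_add
      (Real.logb_nonneg_of_base_lt_one hγ hγ1 ha0 ha1)
      (Real.logb_nonneg_of_base_lt_one hγ hγ1 hb0 hb1)]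

lemma logBase_eq_zero (hγ : 0 < γ) (hγ1 : γ < 1) {m : ℝ≥0∞} (hm : m ≤ 1) (h : logBase γ m = 0) :
    m = 1 := by
  by_cases h0 : m = 0
  · simp [logBase, h0] at h
  have hmt : m ≠ ∞ := ne_top_of_le_ne_top ENNReal.one_ne_top hm
  rw [logBase, if_neg h0, ENNReal.ofReal_eq_zero] at h
  refine le_antisymm hm ?_
  have h1 := (Real.logb_nonpos_iff_of_base_lt_one hγ hγ1 (ENNReal.toReal_pos h0 hmt)).1 h
  rw [← ENNReal.ofReal_toReal hmt]
  simpa using h1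

end PowCost

/-! ### Expected costs and discounts as Bellman values -/

namespace MDP

variable {S A : Type*} [MeasurableSpace S] [MeasurableSpace A]

/-- The one-step cost. -/
noncomputable def stepCost (M : MDP S A) (q : S × A) : ℝ≥0∞ := ENNReal.ofReal (-M.reward q)

/-- The discount `γ ^ cost` incurred in one step. -/
noncomputable def stepDiscount (M : MDP S A) (q : S × A) : ℝ≥0∞ :=
  powCost M.discount (M.stepCost q)

/-- The loss `1 - γ ^ cost` incurred in one step. -/
noncomputable def stepLoss (M : MDP S A) (q : S × A) : ℝ≥0∞ := 1 - M.stepDiscount q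

lemma measurable_stepCost (M : MDP S A) : Measurable M.stepCost :=
  M.measurable_reward.neg.ennreal_ofReal

lemma measurable_stepDiscount (M : MDP S A) : Measurable M.stepDiscount :=
  (measurable_powCost _).comp M.measurable_stepCost

lemma measurable_stepLoss (M : MDP S A) : Measurable M.stepLoss :=
  measurable_const.sub M.measurable_stepDiscount

lemma stepLoss_add_stepDiscount (M : MDP S A) (q : S × A) : M.stepLoss q + M.stepDiscount q = 1 :=
  tsub_add_cancel_of_le (powCost_le_one M.discount_pos M.discount_lt_one _)

lemma totalCost_eq_pathCost (M : MDP S A) (x y : S ⊕ (S × A)) (ω : ℕ → S × A) :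
    M.totalCost x y ω = pathCost M.stepCost 1 x y ω := by
  simp [totalCost, pathCost, stepCost]

/-- A telescoping sum: `1 - γ ^ (total cost)` is the total of the losses `1 - γ ^ cost` in the
single steps, each discounted by the earlier steps. -/
lemma pathCost_add_powCost (M : MDP S A) (x y : S ⊕ (S × A)) (ω : ℕ → S × A) :
    pathCost M.stepLoss M.stepDiscount x y ω +
      powCost M.discount (M.totalCost x y ω) = 1 := by
  classical
  set f : ℕ → ℝ≥0∞ := fun t => if Reached x y ω t then 0 else M.stepCost (ω t) with hf
  set g : ℕ → ℝ≥0∞ := fun t => if Reached x y ω t then 0 else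
    (∏ i ∈ Finset.range t, M.stepDiscount (ω i)) * M.stepLoss (ω t) with hg
  have hpartial : ∀ n, ∑ t ∈ Finset.range n, g t +
      powCost M.discount (∑ t ∈ Finset.range n, f t) = 1 := by
    intro n
    induction n with
    | zero => simp [powCost_zero]
    | succ n ih =>
      rw [Finset.sum_range_succ, Finset.sum_range_succ]
      by_cases hn : Reached x y ω n
      · simpa [hf, hg, hn] using ih
      · have hprod : powCost M.discount (∑ t ∈ Finset.range n, f t) =
            ∏ i ∈ Finset.range n, M.stepDiscount (ω i) := by
          rw [powCost_sum M.discount_pos]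
          refine Finset.prod_congr rfl fun i hi => ?_
          have hi : ¬ Reached x y ω i := fun h => hn (h.mono (Finset.mem_range.1 hi).le)
          simp [hf, hi, stepDiscount]
        have hgn : g n = (∏ i ∈ Finset.range n, M.stepDiscount (ω i)) *
            M.stepLoss (ω n) := if_neg hn
        have hfn : f n = M.stepCost (ω n) := if_neg hn
        rw [powCost_add M.discount_pos, hgn, hfn, hprod, add_assoc, ← stepDiscount, ← mul_add,
          M.stepLoss_add_stepDiscount, mul_one, ← hprod]
        exact ih
  have hfin : ∀ n, ∑ t ∈ Finset.range n, f t ≠ ∞ := fun n =>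
    (ENNReal.sum_lt_top.2 fun t _ => by
      simp only [hf]; split_ifs <;> simp [stepCost]).ne
  have hlim := (ENNReal.tendsto_nat_tsum g).add
    (tendsto_powCost M.discount_pos M.discount_lt_one hfin (ENNReal.tendsto_nat_tsum f))
  simp_rw [hpartial] at hlim
  have hg' : pathCost M.stepLoss M.stepDiscount x y ω = ∑' t, g t := by
    rw [pathCost]
  have hf' : M.totalCost x y ω = ∑' t, f t := by
    rw [totalCost]
    congr!
  rw [hg', hf']
  exact tendsto_nhds_unique hlim tendsto_const_nhds

variable [MeasurableSingletonClass S] [MeasurableSingletonClass A]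

lemma expectedCost_eq_goalValue (M : MDP S A) (π : StationaryPolicy S A) (x y : S ⊕ (S × A)) :
    M.expectedCost π x y = M.goalValue π M.stepCost 1 x y := by
  rw [← lintegral_pathCost M.measurable_stepCost measurable_one]
  exact lintegral_congr fun ω => M.totalCost_eq_pathCost x y ω

lemma goalValue_add_expectedDiscount (M : MDP S A) (π : StationaryPolicy S A)
    (x y : S ⊕ (S × A)) :
    M.goalValue π M.stepLoss M.stepDiscount x y +
      M.expectedDiscount π x y = 1 := by
  rw [← lintegral_pathCost M.measurable_stepLoss M.measurable_stepDiscount, expectedDiscount,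
    ← lintegral_add_left (measurable_pathCost M.measurable_stepLoss M.measurable_stepDiscount x y)]
  simp [pathCost_add_powCost]

lemma expectedDiscount_le_one (M : MDP S A) (π : StationaryPolicy S A) (x y : S ⊕ (S × A)) :
    M.expectedDiscount π x y ≤ 1 :=
  le_add_self.trans_eq (M.goalValue_add_expectedDiscount π x y)

lemma iSup_expectedDiscount_le_one (M : MDP S A) (x y : S ⊕ (S × A)) :
    ⨆ π : StationaryPolicy S A, M.expectedDiscount π x y ≤ 1 :=
  iSup_le fun π => M.expectedDiscount_le_one π x y

lemma expectedDiscount_self (M : MDP S A) (π : StationaryPolicy S A) (x : S ⊕ (S × A)) :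
    M.expectedDiscount π x x = 1 := by
  have h := M.goalValue_add_expectedDiscount π x x
  rwa [goalValue_self M.measurable_stepLoss M.measurable_stepDiscount,
    zero_add] at h

/-- Discounts multiply when `y` is pursued first and `z` afterwards. In terms of the losses
`1 - discount`, a loss `t` on the way to `y` followed by the loss `w` from `y` is
`w + (1 - w) * t`. -/
lemma exists_mul_le_expectedDiscount (M : MDP S A) (π₁ π₂ : StationaryPolicy S A)
    (x y z : S ⊕ (S × A)) : ∃ π : StationaryPolicy S A,
      M.expectedDiscount π₁ x y * M.expectedDiscount π₂ y z ≤ M.expectedDiscount π x z := by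
  by_cases hyz : y = z
  · subst hyz
    exact ⟨π₁, mul_le_of_le_one_right' (M.expectedDiscount_le_one _ _ _)⟩
  set c := M.stepLoss
  set β := M.stepDiscount
  have hcβ : ∀ q, c q + β q = 1 := M.stepLoss_add_stepDiscount
  have h₁ := M.goalValue_add_expectedDiscount π₁ x y
  have h₂ := M.goalValue_add_expectedDiscount π₂ y z
  set κ := M.expectedDiscount π₂ y z with hκ
  set w := M.goalValue π₂ c β y z with hw
  obtain ⟨π, hπ⟩ := exists_goalValue_le (M := M) M.measurable_stepLoss
    M.measurable_stepDiscount π₁ π₂ hyz κ (fun q => le_of_eq (by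
      calc c q + β q * w = (w + κ) * c q + β q * w := by rw [h₂, one_mul]
        _ = (c q + β q) * w + κ * c q := by ring
        _ = w + κ * c q := by rw [hcβ, one_mul]))
  refine ⟨π, ?_⟩
  have h := M.goalValue_add_expectedDiscount π x z
  -- All values are at most `1`, so they can be cancelled in `[0, ∞]`.
  have hfin : w + κ * M.goalValue π₁ c β x y ≠ ∞ := by
    refine ne_top_of_le_ne_top ENNReal.one_ne_top ?_
    calc w + κ * M.goalValue π₁ c β x y ≤ w + κ * 1 := by
          gcongr
          exact le_self_add.trans_eq h₁
      _ = 1 := by rw [mul_one, h₂]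
  refine (ENNReal.add_le_add_iff_left hfin).1 ?_
  calc w + κ * M.goalValue π₁ c β x y + M.expectedDiscount π₁ x y * κ
      = w + κ * (M.goalValue π₁ c β x y + M.expectedDiscount π₁ x y) := by ring
    _ = 1 := by rw [h₁, mul_one, h₂]
    _ = M.goalValue π c β x z + M.expectedDiscount π x z := h.symm
    _ ≤ _ := by gcongr; exact hπ x

/-- Costs add when `y` is pursued first and `z` afterwards. -/
lemma exists_expectedCost_le (M : MDP S A) (π₁ π₂ : StationaryPolicy S A)
    (x y z : S ⊕ (S × A)) : ∃ π : StationaryPolicy S A,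
      M.expectedCost π x z ≤ M.expectedCost π₁ x y + M.expectedCost π₂ y z := by
  by_cases hyz : y = z
  · subst hyz
    exact ⟨π₁, le_self_add⟩
  simp_rw [expectedCost_eq_goalValue]
  obtain ⟨π, hπ⟩ := exists_goalValue_le (M := M) M.measurable_stepCost
    measurable_one π₁ π₂ hyz 1
    (fun q => by simp [add_comm])
  exact ⟨π, by simpa only [one_mul, add_comm] using hπ x⟩

instance [Nonempty A] : Nonempty (StationaryPolicy S A) :=
  ⟨⟨Kernel.const S (Measure.dirac (Classical.arbitrary A)), inferInstance⟩⟩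

lemma dSum_self [Nonempty A] (M : MDP S A) (x : S ⊕ (S × A)) : M.dSum x x = 0 := by
  simp_rw [dSum, expectedCost_eq_goalValue, goalValue_self M.measurable_stepCost measurable_one,
    iInf_const]

lemma dSum_triangle (M : MDP S A) (x y z : S ⊕ (S × A)) :
    M.dSum x z ≤ M.dSum x y + M.dSum y z := by
  unfold dSum
  refine ENNReal.le_iInf_add_iInf fun π₁ π₂ => ?_
  obtain ⟨π, hπ⟩ := M.exists_expectedCost_le π₁ π₂ x y z
  exact (iInf_le _ π).trans hπ

lemma dDisc_self [Nonempty A] (M : MDP S A) (x : S ⊕ (S × A)) : M.dDisc x x = 0 := by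
  simp [dDisc, expectedDiscount_self, logBase_one]

lemma dDisc_triangle (M : MDP S A) (x y z : S ⊕ (S × A)) :
    M.dDisc x z ≤ M.dDisc x y + M.dDisc y z := by
  unfold dDisc
  rw [← logBase_mul M.discount_pos M.discount_lt_one (M.iSup_expectedDiscount_le_one x y)
    (M.iSup_expectedDiscount_le_one y z)]
  refine logBase_anti M.discount_pos M.discount_lt_one ?_ (M.iSup_expectedDiscount_le_one x z)
  rw [ENNReal.iSup_mul]
  refine iSup_le fun π₁ => ?_
  rw [ENNReal.mul_iSup]
  refine iSup_le fun π₂ => ?_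
  obtain ⟨π, hπ⟩ := M.exists_mul_le_expectedDiscount π₁ π₂ x y z
  exact hπ.trans (le_iSup (fun π => M.expectedDiscount π x z) π)

lemma costMinAttained_of_finite [Nonempty A] [Finite A] (M : MDP S A) : M.CostMinAttained := by
  intro x y
  simp_rw [expectedCost_eq_goalValue]
  exact M.exists_goalValue_isMin M.measurable_stepCost measurable_one x y

lemma discountMaxAttained_of_finite [Nonempty A] [Finite A] (M : MDP S A) :
    M.DiscountMaxAttained := by
  intro x y
  obtain ⟨π, hπ⟩ := M.exists_goalValue_isMin
    M.measurable_stepLoss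
    M.measurable_stepDiscount x y
  refine ⟨π, fun π' => ?_⟩
  have h := M.goalValue_add_expectedDiscount π x y
  have h' := M.goalValue_add_expectedDiscount π' x y
  have hfin := ne_top_of_le_ne_top ENNReal.one_ne_top (le_self_add.trans_eq h')
  refine (ENNReal.add_le_add_iff_left hfin).1 ?_
  refine (h'.trans h.symm).trans_le ?_
  gcongr
  exact hπ π'

lemma eq_of_dSum_eq_zero (M : MDP S A) (hR : ∀ s a, M.reward (s, a) < 0)
    (hM : M.CostMinAttained) {x y : S ⊕ (S × A)} (h : M.dSum x y = 0) : x = y := by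
  by_contra hxy
  obtain ⟨π, hπ⟩ := hM x y
  have h0 : M.expectedCost π x y = 0 := le_antisymm ((le_iInf hπ).trans_eq h) zero_le
  rw [expectedCost_eq_goalValue] at h0
  exact goalValue_ne_zero M.measurable_stepCost measurable_one
    (fun q => ENNReal.ofReal_pos.2 (neg_pos.2 (hR q.1 q.2))) hxy h0

lemma eq_of_dDisc_eq_zero (M : MDP S A) (hR : ∀ s a, M.reward (s, a) < 0)
    (hM : M.DiscountMaxAttained) {x y : S ⊕ (S × A)} (h : M.dDisc x y = 0) : x = y := by
  by_contra hxy
  obtain ⟨π, hπ⟩ := hM x y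
  have h1 := logBase_eq_zero M.discount_pos M.discount_lt_one
    (M.iSup_expectedDiscount_le_one x y) h
  have h2 : M.expectedDiscount π x y = 1 :=
    le_antisymm (M.expectedDiscount_le_one π x y) (h1.symm.trans_le (iSup_le hπ))
  have h3 := M.goalValue_add_expectedDiscount π x y
  rw [h2, add_comm] at h3
  refine goalValue_ne_zero M.measurable_stepLoss
    M.measurable_stepDiscount (fun q => tsub_pos_of_lt ?_) hxy
    ((ENNReal.add_right_inj ENNReal.one_ne_top).1 (h3.trans (add_zero 1).symm))
  exact powCost_lt_one M.discount_pos M.discount_lt_one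
    (ENNReal.ofReal_pos.2 (neg_pos.2 (hR q.1 q.2))).ne'

end MDP

theorem mainTheorem11 {S A : Type*} [MeasurableSpace S] [MeasurableSpace A]
    [MeasurableSingletonClass S] [MeasurableSingletonClass A] [Nonempty A]
    (M : MDP S A) (hR : ∀ s a, M.reward (s, a) ≤ 0) :
    IsQuasipseudometric M.dSum ∧ IsQuasipseudometric M.dDisc ∧
    (Finite A → M.CostMinAttained ∧ M.DiscountMaxAttained) ∧
    ((∀ s a, M.reward (s, a) < 0) →
      (M.CostMinAttained → IsQuasimetric M.dSum) ∧
      (M.DiscountMaxAttained → IsQuasimetric M.dDisc)) := by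
  refine ⟨⟨?_, M.dSum_triangle⟩, ⟨?_, M.dDisc_triangle⟩, fun _ =>
    ⟨M.costMinAttained_of_finite, M.discountMaxAttained_of_finite⟩, fun hneg =>
    ⟨fun hM => ⟨fun x y => ⟨?_, M.eq_of_dSum_eq_zero hneg hM⟩, M.dSum_triangle⟩,
      fun hM => ⟨fun x y => ⟨?_, M.eq_of_dDisc_eq_zero hneg hM⟩, M.dDisc_triangle⟩⟩⟩
  · rintro x _ rfl
    exact M.dSum_self x
  · rintro x _ rfl
    exact M.dDisc_self x
  · rintro rfl
    exact M.dSum_self x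
  · rintro rfl
    exact M.dDisc_self x
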